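/- **Worst-case values and quantiles of concave distortions.** Let $U$ be uniform on $(0,1)$. For a probability distribution $G$ on $\mathbb R$ (identified with its distribution function) with finite second moment let $G^{-1}(u)=\inf\{y: G(y)\ge u\}$, $0<u<1$, and let $d_W(G_1,G_2)=\inf\{[\mathbb E(X_1-X_2)^2]^{1/2}: X_1\sim G_1,\ X_2\sim G_2\}$ be the Wasserstein distance of order $2$. Let $g:[0,1]\to[0,1]$ be a non-decreasing, concave, absolutely continuous function with $g(0)=0$, $g(1)=1$, let $$H_g(G)=-\int_{-\infty}^0\bigl(1-g(1-G(x))\bigr)\,dx+\int_0^\infty g(1-G(x))\,dx$$ be the corresponding distortion risk measure, and let $\gamma(u)=\partial_-g(x)|_{x=1-u}$, $0<u<1$ (left derivative) be its weight function; assume $\int_0^1\gamma(u)^2\,du<\infty$ and $\gamma\not\equiv1$. Let $F$ be a distribution with mean $\mu_F$ and standard deviation $\sigma_F>0$, and let $\mu\in\mathbb R$, $\sigma>0$. For $0\le\varepsilon\le\infty$ let $\mathcal M_\varepsilon$ be the set of distributions $G$ with mean $\mu$, standard deviation $\sigma$ and $d_W(F,G)\le\sqrt\varepsilon$. Put $c_0=\mathrm{corr}(F^{-1}(U),\gamma(U))$,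 $V=\mathrm{var}(\gamma(U))$, $C=\mathrm{cov}(F^{-1}(U),\gamma(U))$, $K=\tfrac12(\mu_F^2+\sigma_F^2+\mu^2+\sigma^2-2\mu\mu_F-\varepsilon)$ and, for $\lambda\ge0$, $$h_\lambda(u)=\mu+\sigma\,\frac{\gamma(u)+\lambda F^{-1}(u)-a_\lambda}{b_\lambda},\qquad a_\lambda=\mathbb E(\gamma(U)+\lambda F^{-1}(U)),\quad b_\lambda=\mathrm{std}(\gamma(U)+\lambda F^{-1}(U)).$$ A distribution is said to have quantile function $h_\lambda$ if it is the law of $h_\lambda(U)$; its left-continuous quantile function then equals $h_\lambda$ at every $u\in(0,1)$ at which $\gamma$ is continuous, that is, at all but at most countably many $u$. 1. If $(\mu_F-\mu)^2+(\sigma_F-\sigma)^2<\varepsilon<(\mu_F-\mu)^2+(\sigma_F-\sigma)^2+2\sigma\sigma_F(1-c_0)$, then $K\ge0$, the number $$\lambda=\frac{K}{\sigma_F^2}\sqrt{\frac{C^2-V\sigma_F^2}{K^2-\sigma^2\sigma_F^2}}-\frac{C}{\sigma_F^2}$$ is positive and is the unique positive $\lambda$ for which the distribution with quantile function $h_\lambda$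 is at Wasserstein distance exactly $\sqrt\varepsilon$ from $F$. The distribution with quantile function $h_\lambda$ is the unique maximiser of $H_g$ over $\mathcal M_\varepsilon$, and the worst-case value is $$\sup_{G\in\mathcal M_\varepsilon}H_g(G)=H_g(h_\lambda)=\mu+\frac{\sigma}{b_\lambda}(V+\lambda C)=\mu+\sigma\,\mathrm{std}(\gamma(U))\,\mathrm{corr}\bigl(\gamma(U),\gamma(U)+\lambda F^{-1}(U)\bigr).$$ 2. If $(\mu_F-\mu)^2+(\sigma_F-\sigma)^2<\varepsilon\le\infty$ and $(\mu_F-\mu)^2+(\sigma_F-\sigma)^2+2\sigma\sigma_F(1-c_0)\le\varepsilon$, then the distribution with quantile function $h_0$ is the unique maximiser of $H_g$ over $\mathcal M_\varepsilon$, and the worst-case value is given by the formulas of part 1 with $\lambda=0$. Moreover, the worst-case value is continuous in $\varepsilon$ on $((\mu_F-\mu)^2+(\sigma_F-\sigma)^2,\infty]$. -/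

import Mathlib

open MeasureTheory ProbabilityTheory Set Topology
open scoped ENNReal

noncomputable section

/-- The law of a standard uniform random variable `U` on `(0,1)`. Expectations, variances and
covariances of functions of `U` are taken under this measure. -/
def unifLaw : Measure ℝ := volume.restrict (Ioo (0 : ℝ) 1)

/-- The standard deviation of `X(U)`. -/
def stdU (X : ℝ → ℝ) : ℝ := √(Var[X; unifLaw])

/-- The correlation of `X(U)` and `Y(U)`. -/
def corrU (X Y : ℝ → ℝ) : ℝ := cov[X, Y; unifLaw] / (stdU X * stdU Y)

/-- The left-continuous inverse `u ↦ inf {y | u ≤ G(y)}` of the distribution function of `G`,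
meant for `0 < u < 1`. -/
def quantile (G : Measure ℝ) (u : ℝ) : ℝ := sInf {y : ℝ | u ≤ cdf G y}

/-- A distortion function (only its values on `[0,1]` matter). -/
structure IsDistortion (g : ℝ → ℝ) : Prop where
  mono : MonotoneOn g (Icc 0 1)
  zero : g 0 = 0
  one : g 1 = 1

/-- The weight function: the derivative from the left of `g` at `1 - u`, for `0 < u < 1`. -/
def weight (g : ℝ → ℝ) (u : ℝ) : ℝ := derivWithin g (Iio (1 - u)) (1 - u)

/-- The distortion risk measure, as the Choquet integral
`∫_0^∞ g(1 - G(x)) dx - ∫_{-∞}^0 (1 - g(1 - G(x))) dx`. Both integrands are nonnegative, so both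
integrals exist in `[0,∞]`; the difference is meaningful when one of them is finite. -/
def distortionRisk (g : ℝ → ℝ) (G : Measure ℝ) : EReal :=
  ((∫⁻ x in Ioi (0 : ℝ), ENNReal.ofReal (g (1 - cdf G x)) : ℝ≥0∞) : EReal)
    - ((∫⁻ x in Iic (0 : ℝ), ENNReal.ofReal (1 - g (1 - cdf G x)) : ℝ≥0∞) : EReal)

/-- The Wasserstein distance of order 2: the infimum of `(E (X₁ - X₂)²)^{1/2}` over all bivariate
distributions with marginals `G₁` and `G₂`. -/
def wasserstein2 (G₁ G₂ : Measure ℝ) : ℝ≥0∞ :=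
  ⨅ π ∈ {π : Measure (ℝ × ℝ) | π.map Prod.fst = G₁ ∧ π.map Prod.snd = G₂},
    (∫⁻ p, ENNReal.ofReal ((p.1 - p.2) ^ 2) ∂π) ^ (1 / 2 : ℝ)

/-- The probability distributions on `ℝ` with finite second moment, mean `m` and
second moment `m² + s²`. -/
def momentSet (m s : ℝ) : Set (Measure ℝ) :=
  {G | IsProbabilityMeasure G ∧ MemLp (fun x : ℝ => x) 2 G ∧
    ∫ x, x ∂G = m ∧ ∫ x, x ^ 2 ∂G = m ^ 2 + s ^ 2}

/-- The uncertainty set: the distributions with mean `m` and standard deviation `s` whose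
Wasserstein distance to `F` is at most `√ε`, where `0 ≤ ε ≤ ∞`. -/
def uncertaintySet (F : Measure ℝ) (m s : ℝ) (ε : ℝ≥0∞) : Set (Measure ℝ) :=
  {G | G ∈ momentSet m s ∧ wasserstein2 F G ≤ ε ^ (1 / 2 : ℝ)}

/-- The solutions of the worst-case problem: the maximisers of the distortion risk measure over
the uncertainty set. -/
def worstCaseArgmax (g : ℝ → ℝ) (F : Measure ℝ) (m s : ℝ) (ε : ℝ≥0∞) : Set (Measure ℝ) :=
  {G | G ∈ uncertaintySet F m s ε ∧
    ∀ G' ∈ uncertaintySet F m s ε, distortionRisk g G' ≤ distortionRisk g G}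

/-- The worst-case value: the supremum of the distortion risk measure over the uncertainty set. -/
def worstCaseValue (g : ℝ → ℝ) (F : Measure ℝ) (m s : ℝ) (ε : ℝ≥0∞) : EReal :=
  sSup (distortionRisk g '' uncertaintySet F m s ε)

/-- The function `γ + l F⁻¹`. -/
def mixFun (g : ℝ → ℝ) (F : Measure ℝ) (l u : ℝ) : ℝ := weight g u + l * quantile F u

/-- The function `h_l = m + s (γ + l F⁻¹ - a_l) / b_l`, where `a_l` and `b_l` are the mean and the
standard deviation of `γ(U) + l F⁻¹(U)`. -/
def hFun (g : ℝ → ℝ) (F : Measure ℝ) (m s l u : ℝ) : ℝ :=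
  m + s * ((mixFun g F l u - ∫ v, mixFun g F l v ∂unifLaw) / stdU (mixFun g F l))

/-- The distribution of `h_l(U)`. -/
def hLaw (g : ℝ → ℝ) (F : Measure ℝ) (m s l : ℝ) : Measure ℝ := unifLaw.map (hFun g F m s l)

/-- The quantile function of `G` is given by `h_l`. As `γ` is a left derivative evaluated at
`1 - u`, it is right-continuous in `u`, whereas quantile functions are left-continuous; so the
identity is stated at each `u` where `γ` is continuous, which leaves out only countably many `u`. -/
def QuantileGivenByH (g : ℝ → ℝ) (F : Measure ℝ) (m s l : ℝ) (G : Measure ℝ) : Prop :=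
  (∀ u ∈ Ioo (0 : ℝ) 1, ContinuousAt (weight g) u → quantile G u = hFun g F m s l u) ∧
    {u ∈ Ioo (0 : ℝ) 1 | quantile G u ≠ hFun g F m s l u}.Countable

/-- `V = Var γ(U)`. -/
def weightVar (g : ℝ → ℝ) : ℝ := Var[weight g; unifLaw]

/-- `C = Cov (F⁻¹(U), γ(U))`. -/
def quantileWeightCov (g : ℝ → ℝ) (F : Measure ℝ) : ℝ := cov[quantile F, weight g; unifLaw]

/-- `K = (μ_F² + σ_F² + μ² + σ² - 2 μ μ_F - ε) / 2`. -/
def kConst (mF sF m s ε : ℝ) : ℝ := (mF ^ 2 + sF ^ 2 + m ^ 2 + s ^ 2 - 2 * m * mF - ε) / 2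

/-- The explicit multiplier `(K / σ_F²) √((C² - V σ_F²) / (K² - σ² σ_F²)) - C / σ_F²`. -/
def lamExplicit (g : ℝ → ℝ) (F : Measure ℝ) (mF sF m s ε : ℝ) : ℝ :=
  kConst mF sF m s ε / sF ^ 2 *
      √((quantileWeightCov g F ^ 2 - weightVar g * sF ^ 2) /
        (kConst mF sF m s ε ^ 2 - s ^ 2 * sF ^ 2))
    - quantileWeightCov g F / sF ^ 2

/-- The value `μ + (σ / b_l) (V + l C)`. -/
def valueFormula (g : ℝ → ℝ) (F : Measure ℝ) (m s l : ℝ) : ℝ :=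
  m + s / stdU (mixFun g F l) * (weightVar g + l * quantileWeightCov g F)

/-- The lower bound `(μ_F - μ)² + (σ_F - σ)²` of the admissible tolerances. -/
def epsLower (mF sF m s : ℝ) : ℝ := (mF - m) ^ 2 + (sF - s) ^ 2

/-- The threshold `(μ_F - μ)² + (σ_F - σ)² + 2 σ σ_F (1 - c₀)`, `c₀ = corr (F⁻¹(U), γ(U))`. -/
def epsThreshold (g : ℝ → ℝ) (F : Measure ℝ) (mF sF m s : ℝ) : ℝ :=
  epsLower mF sF m s + 2 * s * sF * (1 - corrU (quantile F) (weight g))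

end

open Filter

/-! Passing to quantile functions turns the problem into the maximisation of a linear functional on
a sphere in `L²(0,1)`. The comonotone coupling is optimal (`wasserstein2_eq`), so the Wasserstein
distance is the `L²` distance of quantile functions. With means and variances fixed, the ball
constraint becomes `K ≤ cov(F⁻¹, G⁻¹)` (`mem_uncertaintySet_iff`). The layer-cake formula and `E γ =
1` give `H_g(G) = μ + cov(G⁻¹, γ)` (`distortionRisk_eq_add_covariance`).

For a multiplier `l ≥ 0`, completing the square (`distortionRisk_eq_sub`) yields `cov(X, γ + l F⁻¹)
= σ b_l - b_l / (2σ) · E (X - h_l)²` for every `X` with mean `μ` and variance `σ²`. Hence `h_l`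
alone maximises the Lagrangian, and complementary slackness (`worstCase_of_slackness`) makes it the
unique solution. It is admissible because `γ` and `F⁻¹` are monotone, so that `h_l` is a.e. the
quantile function of its own law.

Above the threshold `h_0` is feasible and `l = 0` works. Below it the constraint must bind: `(σ /
b_l)(C + l σ_F²) = K`, whose square is linear in `(C + l σ_F²)²` and has one positive solution `l`.
The resulting value is an explicit continuous function of `ε` that matches the `h_0` value at the
threshold. -/

/-! ### Quantile functions under the uniform law. -/

theorem unifLaw_eq_restrict_Ioc : unifLaw = volume.restrict (Ioc (0 : ℝ) 1) :=
  Measure.restrict_congr_set Ioo_ae_eq_Ioc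

instance : IsProbabilityMeasure unifLaw := ⟨by simp [unifLaw]⟩

theorem ae_unifLaw_mem : ∀ᵐ u ∂unifLaw, u ∈ Ioo (0 : ℝ) 1 :=
  ae_restrict_mem measurableSet_Ioo

theorem unifLaw_Ioc {a b : ℝ} (ha : 0 ≤ a) (hb : b ≤ 1) :
    unifLaw (Ioc a b) = ENNReal.ofReal (b - a) := by
  rw [unifLaw_eq_restrict_Ioc, Measure.restrict_apply measurableSet_Ioc,
    inter_eq_left.2 (Ioc_subset_Ioc ha hb), Real.volume_Ioc]

theorem ae_unifLaw_of_countable {p : ℝ → Prop} (h : {u ∈ Ioo (0 : ℝ) 1 | ¬ p u}.Countable) :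
    ∀ᵐ u ∂unifLaw, p u := by
  have h0 : ∀ᵐ u ∂unifLaw, u ∉ {u ∈ Ioo (0 : ℝ) 1 | ¬ p u} :=
    ae_restrict_of_ae (h.ae_notMem _)
  filter_upwards [ae_unifLaw_mem, h0] with u hu hn
  by_contra hp
  exact hn ⟨hu, hp⟩

/-- The Galois connection between quantile and distribution function: right-continuity of `cdf G`
makes the infimum attained, and `0 < u < 1` makes the set nonempty and bounded below. -/
theorem quantile_le_iff (G : Measure ℝ) {u x : ℝ} (hu : u ∈ Ioo (0 : ℝ) 1) :
    quantile G u ≤ x ↔ u ≤ cdf G x := by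
  obtain ⟨y₀, hy₀⟩ := ((tendsto_cdf_atBot G).eventually (gt_mem_nhds hu.1)).exists
  obtain ⟨y₁, hy₁⟩ := ((tendsto_cdf_atTop G).eventually (lt_mem_nhds hu.2)).exists
  have hlow : ∀ y, cdf G y < u → y ∈ lowerBounds {y : ℝ | u ≤ cdf G y} := by
    intro y hy z hz
    by_contra! hzy
    exact absurd (hz.trans (monotone_cdf G hzy.le)) (not_le.2 hy)
  constructor
  · intro h
    by_contra! hlt
    have hev : ∀ᶠ y in 𝓝[>] x, cdf G y < u :=
      (((cdf G).right_continuous x).tendsto.mono_left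
        (nhdsWithin_mono x Ioi_subset_Ici_self)).eventually (gt_mem_nhds hlt)
    obtain ⟨y, hy, hxy⟩ := (hev.and self_mem_nhdsWithin).exists
    have := le_csInf ⟨y₁, hy₁.le⟩ (hlow y hy)
    exact absurd (this.trans h) (not_le.2 hxy)
  · intro h
    exact csInf_le ⟨y₀, hlow y₀ hy₀⟩ h

theorem lt_quantile_iff (G : Measure ℝ) {u x : ℝ} (hu : u ∈ Ioo (0 : ℝ) 1) :
    x < quantile G u ↔ cdf G x < u := by
  rw [← not_le, quantile_le_iff G hu, not_le]

theorem quantile_monotoneOn (G : Measure ℝ) : MonotoneOn (quantile G) (Ioo 0 1) := by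
  intro u hu v hv huv
  rw [quantile_le_iff G hu]
  exact huv.trans ((quantile_le_iff G hv).1 le_rfl)

theorem aemeasurable_quantile (G : Measure ℝ) : AEMeasurable (quantile G) unifLaw :=
  aemeasurable_restrict_of_monotoneOn measurableSet_Ioo (quantile_monotoneOn G)

theorem map_quantile (G : Measure ℝ) [IsProbabilityMeasure G] :
    unifLaw.map (quantile G) = G := by
  have := Measure.isProbabilityMeasure_map (aemeasurable_quantile G)
  refine Measure.ext_of_Iic _ _ fun x => ?_
  rw [Measure.map_apply_of_aemeasurable (aemeasurable_quantile G) measurableSet_Iic,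
    ← ofReal_cdf G x]
  have h : (quantile G ⁻¹' Iic x : Set ℝ) =ᵐ[unifLaw] Ioc 0 (cdf G x) := by
    filter_upwards [ae_unifLaw_mem] with u hu
    apply propext
    change quantile G u ≤ x ↔ 0 < u ∧ u ≤ cdf G x
    rw [quantile_le_iff G hu]
    exact ⟨fun h => ⟨hu.1, h⟩, fun h => h.2⟩
  rw [measure_congr h, unifLaw_Ioc le_rfl (cdf_le_one G x), sub_zero]

theorem quantile_continuousWithinAt (G : Measure ℝ) {u : ℝ} (hu : u ∈ Ioo (0 : ℝ) 1) :
    ContinuousWithinAt (quantile G) (Iio u) u := by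
  refine tendsto_order.2 ⟨fun y hy => ?_, fun y hy => ?_⟩
  · rw [lt_quantile_iff G hu] at hy
    filter_upwards [self_mem_nhdsWithin, mem_nhdsWithin_of_mem_nhds (lt_mem_nhds hy)] with v hvu hyv
    exact (lt_quantile_iff G ⟨(cdf_nonneg G y).trans_lt hyv, lt_trans hvu hu.2⟩).2 hyv
  · filter_upwards [self_mem_nhdsWithin, mem_nhdsWithin_of_mem_nhds (lt_mem_nhds hu.1)]
      with v hvu hv0
    exact (quantile_monotoneOn G ⟨hv0, lt_trans hvu hu.2⟩ hu (le_of_lt hvu)).trans_lt hy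

/-- At a point of left continuity, a monotone function is the quantile function of its law. -/
theorem quantile_map_eq {h : ℝ → ℝ} (hm : MonotoneOn h (Ioo 0 1)) {u : ℝ}
    (hu : u ∈ Ioo (0 : ℝ) 1) (hc : ContinuousWithinAt h (Iio u) u) :
    quantile (unifLaw.map h) u = h u := by
  have hmeas : AEMeasurable h unifLaw :=
    aemeasurable_restrict_of_monotoneOn measurableSet_Ioo hm
  have := Measure.isProbabilityMeasure_map hmeas
  apply le_antisymm
  · rw [quantile_le_iff _ hu, ← ENNReal.ofReal_le_ofReal_iff (cdf_nonneg _ _), ofReal_cdf,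
      Measure.map_apply_of_aemeasurable hmeas measurableSet_Iic, ← sub_zero u,
      ← unifLaw_Ioc le_rfl hu.2.le, sub_zero]
    exact measure_mono fun v hv => hm ⟨hv.1, hv.2.trans_lt hu.2⟩ hu hv.2
  · by_contra! hlt
    obtain ⟨y, hqy, hyh⟩ := exists_between hlt
    have hev : ∀ᶠ v in 𝓝[<] u, y < h v ∧ 0 < v :=
      (hc.eventually (lt_mem_nhds hyh)).and
        ((lt_mem_nhds hu.1).filter_mono nhdsWithin_le_nhds)
    -- Left continuity gives `v < u` with `y < h v`; by monotonicity `h ≤ y` only to the left of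
    -- `v`, so the distribution function at `y` is at most `v`, hence below `u`.
    obtain ⟨v, ⟨hyv, hv0⟩, hvu⟩ := (hev.and self_mem_nhdsWithin).exists
    have hvu : v < u := hvu
    have h1 := (quantile_le_iff (unifLaw.map h) hu).1 hqy.le
    have h2 : cdf (unifLaw.map h) y ≤ v := by
      rw [← ENNReal.ofReal_le_ofReal_iff hv0.le, ofReal_cdf,
        Measure.map_apply_of_aemeasurable hmeas measurableSet_Iic, ← sub_zero v,
        ← unifLaw_Ioc le_rfl (hvu.trans hu.2).le]
      refine measure_mono_ae ?_
      filter_upwards [ae_unifLaw_mem] with w hw hwy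
      refine ⟨hw.1, ?_⟩
      by_contra! hvw
      exact absurd ((hm ⟨hv0, hvu.trans hu.2⟩ hw hvw.le).trans hwy) (not_le.2 hyv)
    linarith

/-! ### The Wasserstein distance and the comonotone coupling. -/

/-- The squared distance as the area of a square, cut out by `min` and `max`. -/
theorem ofReal_sub_sq_eq_lintegral (x y : ℝ) :
    ENNReal.ofReal ((x - y) ^ 2) = ∫⁻ p : ℝ × ℝ,
      ({p : ℝ × ℝ | x ≤ min p.1 p.2 ∧ max p.1 p.2 < y}.indicator 1 p +
        {p : ℝ × ℝ | y ≤ min p.1 p.2 ∧ max p.1 p.2 < x}.indicator 1 p) := by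
  have key : ∀ a b : ℝ, {p : ℝ × ℝ | a ≤ min p.1 p.2 ∧ max p.1 p.2 < b} =
      Ico a b ×ˢ Ico a b := by
    intro a b
    ext p
    simp only [le_min_iff, max_lt_iff, mem_ofPred_eq, mem_prod, mem_Ico]
    tauto
  have vol : ∀ a b : ℝ, volume (Ico a b ×ˢ Ico a b : Set (ℝ × ℝ)) =
      ENNReal.ofReal (b - a) * ENNReal.ofReal (b - a) := by
    intro a b
    rw [Measure.volume_eq_prod, Measure.prod_prod, Real.volume_Ico]
  have hms : ∀ a b : ℝ, MeasurableSet (Ico a b ×ˢ Ico a b : Set (ℝ × ℝ)) :=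
    fun a b => measurableSet_Ico.prod measurableSet_Ico
  rw [key, key, lintegral_add_left (measurable_one.indicator (hms x y)),
    lintegral_indicator_one (hms x y), lintegral_indicator_one (hms y x), vol, vol]
  rcases le_total x y with h | h
  · rw [ENNReal.ofReal_of_nonpos (sub_nonpos.2 h), mul_zero, add_zero,
      ← ENNReal.ofReal_mul (sub_nonneg.2 h)]
    congr 1; ring
  · rw [ENNReal.ofReal_of_nonpos (sub_nonpos.2 h), mul_zero, zero_add,
      ← ENNReal.ofReal_mul (sub_nonneg.2 h)]
    congr 1; ring

/-- By Tonelli, the cost depends on the coupling only through the probabilities that one variable is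
at most `a` while the other exceeds `b`; it suffices to minimise each of these. -/
theorem lintegral_sub_sq_eq {Ω : Type*} [MeasurableSpace Ω] (P : Measure Ω) [SFinite P]
    {X Y : Ω → ℝ} (hX : Measurable X) (hY : Measurable Y) :
    ∫⁻ w, ENNReal.ofReal ((X w - Y w) ^ 2) ∂P = ∫⁻ p : ℝ × ℝ,
      (P {w | X w ≤ min p.1 p.2 ∧ max p.1 p.2 < Y w} +
        P {w | Y w ≤ min p.1 p.2 ∧ max p.1 p.2 < X w}) := by
  have hms : ∀ {X Y : Ω → ℝ}, Measurable X → Measurable Y → MeasurableSet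
      {z : Ω × (ℝ × ℝ) | X z.1 ≤ min z.2.1 z.2.2 ∧ max z.2.1 z.2.2 < Y z.1} := by
    intro X Y hX hY
    exact (measurableSet_le (hX.comp measurable_fst) (by fun_prop)).inter
      (measurableSet_lt (by fun_prop) (hY.comp measurable_fst))
  simp_rw [ofReal_sub_sq_eq_lintegral]
  rw [lintegral_lintegral_swap]
  · refine lintegral_congr fun p => ?_
    have h1 : MeasurableSet {w | X w ≤ min p.1 p.2 ∧ max p.1 p.2 < Y w} :=
      measurable_prodMk_right (y := p) (hms hX hY)
    have h2 : MeasurableSet {w | Y w ≤ min p.1 p.2 ∧ max p.1 p.2 < X w} :=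
      measurable_prodMk_right (y := p) (hms hY hX)
    rw [← lintegral_indicator_one h1, ← lintegral_indicator_one h2,
      ← lintegral_add_left (measurable_one.indicator h1)]
    rfl
  · exact ((measurable_one.indicator (hms hX hY)).add
      (measurable_one.indicator (hms hY hX))).aemeasurable

theorem measure_Iic_sub_le {P : Measure (ℝ × ℝ)} {F G : Measure ℝ}
    (hF : P.map Prod.fst = F) (hG : P.map Prod.snd = G) (a b : ℝ) :
    F (Iic a) - G (Iic b) ≤ P {w | w.1 ≤ a ∧ b < w.2} := by
  rw [← hF, ← hG, Measure.map_apply measurable_fst measurableSet_Iic,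
    Measure.map_apply measurable_snd measurableSet_Iic, tsub_le_iff_right]
  refine (measure_mono fun w hw => ?_).trans (measure_union_le _ _)
  by_cases h : b < w.2
  · exact Or.inl ⟨hw, h⟩
  · exact Or.inr (not_lt.1 h)

/-- The comonotone coupling attains the lower bound of `measure_Iic_sub_le` for all `a`, `b` at
once: the event is an interval of `u`, and truncated subtraction covers the empty case. -/
theorem unifLaw_quantile_le_lt (F G : Measure ℝ) [IsProbabilityMeasure F]
    [IsProbabilityMeasure G] (a b : ℝ) :
    unifLaw {u | quantile F u ≤ a ∧ b < quantile G u} = F (Iic a) - G (Iic b) := by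
  have h : ({u | quantile F u ≤ a ∧ b < quantile G u} : Set ℝ) =ᵐ[unifLaw]
      Ioc (cdf G b) (cdf F a) := by
    filter_upwards [ae_unifLaw_mem] with u hu
    apply propext
    change (quantile F u ≤ a ∧ b < quantile G u) ↔ cdf G b < u ∧ u ≤ cdf F a
    rw [quantile_le_iff F hu, lt_quantile_iff G hu, and_comm]
  rw [measure_congr h, unifLaw_Ioc (cdf_nonneg G b) (cdf_le_one F a),
    ENNReal.ofReal_sub _ (cdf_nonneg G b), ofReal_cdf, ofReal_cdf]

/-- The law of the comonotone coupling. -/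
noncomputable def comonotone (F G : Measure ℝ) : Measure (ℝ × ℝ) :=
  unifLaw.map fun u => (quantile F u, quantile G u)

theorem lintegral_comonotone (F G : Measure ℝ) :
    ∫⁻ p, ENNReal.ofReal ((p.1 - p.2) ^ 2) ∂comonotone F G =
      ∫⁻ u, ENNReal.ofReal ((quantile F u - quantile G u) ^ 2) ∂unifLaw :=
  lintegral_map' (by fun_prop) ((aemeasurable_quantile F).prodMk (aemeasurable_quantile G))

/-- The comonotone coupling is optimal. -/
theorem wasserstein2_eq (F G : Measure ℝ) [IsProbabilityMeasure F] [IsProbabilityMeasure G] :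
    wasserstein2 F G =
      (∫⁻ u, ENNReal.ofReal ((quantile F u - quantile G u) ^ 2) ∂unifLaw) ^ (1 / 2 : ℝ) := by
  have hpair := (aemeasurable_quantile F).prodMk (aemeasurable_quantile G)
  have := Measure.isProbabilityMeasure_map hpair
  have : IsProbabilityMeasure (comonotone F G) := this
  have hfst : (comonotone F G).map Prod.fst = F := by
    rw [comonotone, AEMeasurable.map_map_of_aemeasurable measurable_fst.aemeasurable hpair]
    exact map_quantile F
  have hsnd : (comonotone F G).map Prod.snd = G := by
    rw [comonotone, AEMeasurable.map_map_of_aemeasurable measurable_snd.aemeasurable hpair]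
    exact map_quantile G
  rw [← lintegral_comonotone]
  apply le_antisymm
  · exact iInf₂_le (comonotone F G) ⟨hfst, hsnd⟩
  · refine le_iInf₂ fun P hP => ENNReal.rpow_le_rpow ?_ (by norm_num)
    obtain ⟨h1, h2⟩ := hP
    -- The infimum ranges over all measures with the given marginals; these force total mass one.
    have : IsProbabilityMeasure P := by
      constructor
      have h := congrArg (fun μ : Measure ℝ => μ univ) h1
      simpa [Measure.map_apply measurable_fst] using h
    have hms : ∀ a b : ℝ, MeasurableSet {w : ℝ × ℝ | w.1 ≤ a ∧ b < w.2} := fun a b =>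
      (measurableSet_le measurable_fst measurable_const).inter
        (measurableSet_lt measurable_const measurable_snd)
    have hms' : ∀ a b : ℝ, MeasurableSet {w : ℝ × ℝ | w.2 ≤ a ∧ b < w.1} := fun a b =>
      (measurableSet_le measurable_snd measurable_const).inter
        (measurableSet_lt measurable_const measurable_fst)
    rw [lintegral_sub_sq_eq _ measurable_fst measurable_snd,
      lintegral_sub_sq_eq _ measurable_fst measurable_snd]
    refine lintegral_mono fun p => add_le_add ?_ ?_
    · rw [comonotone, Measure.map_apply_of_aemeasurable hpair (hms _ _)]
      refine (unifLaw_quantile_le_lt F G _ _).trans_le ?_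
      exact measure_Iic_sub_le h1 h2 _ _
    · rw [comonotone, Measure.map_apply_of_aemeasurable hpair (hms' _ _)]
      refine (unifLaw_quantile_le_lt G F _ _).trans_le ?_
      have hswap := measure_Iic_sub_le (P := P.map Prod.swap) (F := G) (G := F)
        (by rw [Measure.map_map measurable_fst measurable_swap]; exact h2)
        (by rw [Measure.map_map measurable_snd measurable_swap]; exact h1)
        (min p.1 p.2) (max p.1 p.2)
      rwa [Measure.map_apply measurable_swap (hms _ _)] at hswap

/-! ### The weight function and the risk measure as a weighted quantile integral. -/

theorem weight_monotoneOn {g : ℝ → ℝ} (hconc : ConcaveOn ℝ (Icc 0 1) g) :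
    MonotoneOn (weight g) (Ioo 0 1) := by
  intro u hu v hv huv
  have h := hconc.neg.monotoneOn_leftDeriv (a := 1 - v) (b := 1 - u)
    (by rw [interior_Icc]; exact ⟨by linarith [hv.2], by linarith [hv.1]⟩)
    (by rw [interior_Icc]; exact ⟨by linarith [hu.2], by linarith [hu.1]⟩) (by linarith)
  simp only [derivWithin.neg, neg_le_neg_iff] at h
  exact h

theorem weight_nonneg {g : ℝ → ℝ} (hmono : MonotoneOn g (Icc 0 1)) {u : ℝ}
    (hu : u ∈ Ioo (0 : ℝ) 1) : 0 ≤ weight g u := by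
  -- Monotonicity of `g` is known only on `[0,1]`, so the left derivative is localised there.
  have hset : derivWithin g (Iio (1 - u)) (1 - u) = derivWithin g (Ioo 0 (1 - u)) (1 - u) := by
    refine derivWithin_congr_set ?_
    filter_upwards [lt_mem_nhds (show 0 < 1 - u by linarith [hu.2])] with x hx
    exact propext ⟨fun h => ⟨hx, h⟩, fun h => h.2⟩
  rw [weight, hset]
  refine MonotoneOn.derivWithin_nonneg (hmono.mono fun x hx => ?_)
  exact ⟨hx.1.le, by linarith [hx.2, hu.1]⟩

/-- The fundamental theorem of calculus for absolutely continuous functions, as the left derivative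
equals the derivative almost everywhere. -/
theorem integral_weight {g : ℝ → ℝ} (hac : AbsolutelyContinuousOnInterval g 0 1) {a b : ℝ}
    (ha : 0 ≤ a) (hab : a ≤ b) (hb : b ≤ 1) :
    ∫ u in a..b, weight g u = g (1 - a) - g (1 - b) := by
  have hsub : uIcc (1 - b) (1 - a) ⊆ uIcc 0 1 := by
    rw [uIcc_of_le (by linarith), uIcc_of_le zero_le_one]
    exact Icc_subset_Icc (by linarith) (by linarith)
  have hac' := hac.mono hsub
  unfold weight
  rw [intervalIntegral.integral_comp_sub_left (fun x => derivWithin g (Iio x) x),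
    ← hac'.integral_deriv_eq_sub]
  refine intervalIntegral.integral_congr_ae ?_
  filter_upwards [hac'.ae_differentiableAt] with x hx hxm
  exact ((hx (uIoc_subset_uIcc hxm)).hasDerivAt.hasDerivWithinAt).derivWithin
    (uniqueDiffWithinAt_Iio x)

theorem integral_weight_unifLaw {g : ℝ → ℝ} (hg : IsDistortion g)
    (hac : AbsolutelyContinuousOnInterval g 0 1) : ∫ u, weight g u ∂unifLaw = 1 := by
  have h := integral_weight hac le_rfl zero_le_one le_rfl
  rw [intervalIntegral.integral_of_le zero_le_one, ← unifLaw_eq_restrict_Ioc] at h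
  simpa [hg.zero, hg.one] using h

theorem weight_ae_nonneg {g : ℝ → ℝ} (hg : IsDistortion g) : 0 ≤ᵐ[unifLaw] weight g := by
  filter_upwards [ae_unifLaw_mem] with u hu using weight_nonneg hg.mono hu

/-- The law with density `γ` with respect to the uniform law. -/
noncomputable def weightedLaw (g : ℝ → ℝ) : Measure ℝ :=
  unifLaw.withDensity fun u => ENNReal.ofReal (weight g u)

theorem weightedLaw_Ioc {g : ℝ → ℝ} (hg : IsDistortion g)
    (hac : AbsolutelyContinuousOnInterval g 0 1) (hint : Integrable (weight g) unifLaw)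
    {a b : ℝ} (ha : 0 ≤ a) (hab : a ≤ b) (hb : b ≤ 1) :
    weightedLaw g (Ioc a b) = ENNReal.ofReal (g (1 - a) - g (1 - b)) := by
  rw [weightedLaw, withDensity_apply _ measurableSet_Ioc,
    ← ofReal_integral_eq_lintegral_ofReal hint.integrableOn
      (ae_restrict_of_ae (weight_ae_nonneg hg)),
    ← integral_weight hac ha hab hb, intervalIntegral.integral_of_le hab, unifLaw_eq_restrict_Ioc,
    Measure.restrict_restrict measurableSet_Ioc, inter_eq_left.2 (Ioc_subset_Ioc ha hb)]

/-- Under `weightedLaw g` the event `x < quantile G` has mass `g (1 - cdf G x)`, so both Choquet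
integrals are layer-cake formulas for the parts of `quantile G`. They are finite because `γ` and
`quantile G` are square integrable. -/
theorem distortionRisk_eq {g : ℝ → ℝ} (hg : IsDistortion g)
    (hac : AbsolutelyContinuousOnInterval g 0 1) (hsq : MemLp (weight g) 2 unifLaw)
    {G : Measure ℝ} (hG : MemLp (quantile G) 2 unifLaw) :
    distortionRisk g G = ((∫ u, weight g u * quantile G u ∂unifLaw : ℝ) : EReal) := by
  have hint : Integrable (weight g) unifLaw := hsq.integrable (by norm_num)
  have hprod : Integrable (fun u => weight g u * quantile G u) unifLaw := hsq.integrable_mul hG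
  have hacν : weightedLaw g ≪ unifLaw := withDensity_absolutelyContinuous _ _
  have hmem : ∀ᵐ u ∂weightedLaw g, u ∈ Ioo (0 : ℝ) 1 := hacν.ae_le ae_unifLaw_mem
  have hqν : AEMeasurable (quantile G) (weightedLaw g) := (aemeasurable_quantile G).mono_ac hacν
  have hwm : AEMeasurable (fun u => ENNReal.ofReal (weight g u)) unifLaw :=
    hint.aemeasurable.ennreal_ofReal
  have htoReal : ∀ᵐ u ∂unifLaw, (ENNReal.ofReal (weight g u)).toReal • quantile G u =
      weight g u * quantile G u := by
    filter_upwards [weight_ae_nonneg hg] with u hu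
    rw [ENNReal.toReal_ofReal hu, smul_eq_mul]
  have hqint : Integrable (quantile G) (weightedLaw g) := by
    rw [weightedLaw, integrable_withDensity_iff_integrable_smul₀' hwm (by simp)]
    exact hprod.congr (by filter_upwards [htoReal] with u hu using hu.symm)
  have hval : ∫ u, quantile G u ∂weightedLaw g = ∫ u, weight g u * quantile G u ∂unifLaw := by
    rw [weightedLaw, integral_withDensity_eq_integral_toReal_smul₀ hwm (by simp)]
    exact integral_congr_ae htoReal
  have hpos : ∫⁻ x in Ioi (0 : ℝ), ENNReal.ofReal (g (1 - cdf G x)) =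
      ∫⁻ u, ENNReal.ofReal (quantile G u) ∂weightedLaw g := by
    have h := lintegral_eq_lintegral_meas_lt (weightedLaw g)
      (f := fun u => max (quantile G u) 0) (ae_of_all _ fun u => le_max_right _ _)
      (hqν.max aemeasurable_const)
    simp only [ENNReal.ofReal_max, ENNReal.ofReal_zero, zero_le, max_eq_left] at h
    rw [h]
    refine setLIntegral_congr_fun measurableSet_Ioi fun x hx => ?_
    have hset : ({u | x < max (quantile G u) 0} : Set ℝ) =ᵐ[weightedLaw g] Ioc (cdf G x) 1 := by
      filter_upwards [hmem] with u hu
      apply propext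
      change x < max (quantile G u) 0 ↔ cdf G x < u ∧ u ≤ 1
      rw [lt_max_iff, or_iff_left (not_lt.2 (le_of_lt hx)), lt_quantile_iff G hu]
      exact ⟨fun h => ⟨h, hu.2.le⟩, fun h => h.1⟩
    rw [measure_congr hset, weightedLaw_Ioc hg hac hint (cdf_nonneg G x) (cdf_le_one G x) le_rfl,
      sub_self, hg.zero, sub_zero]
  have hneg : ∫⁻ x in Iic (0 : ℝ), ENNReal.ofReal (1 - g (1 - cdf G x)) =
      ∫⁻ u, ENNReal.ofReal (-quantile G u) ∂weightedLaw g := by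
    -- The layer cake with `≤` matches `quantile G u ≤ -x ↔ u ≤ cdf G (-x)` exactly, without left
    -- limits of the distribution function.
    have h := lintegral_eq_lintegral_meas_le (weightedLaw g)
      (f := fun u => max (-quantile G u) 0) (ae_of_all _ fun u => le_max_right _ _)
      (hqν.neg.max aemeasurable_const)
    simp only [ENNReal.ofReal_max, ENNReal.ofReal_zero, zero_le, max_eq_left] at h
    rw [h, ← Measure.restrict_congr_set (Iio_ae_eq_Iic (a := (0 : ℝ))),
      ← (Measure.measurePreserving_neg (volume : Measure ℝ)).setLIntegral_comp_preimage_emb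
        (MeasurableEquiv.neg ℝ).measurableEmbedding]
    have hpre : (Neg.neg ⁻¹' Iio (0 : ℝ) : Set ℝ) = Ioi 0 := by ext; simp
    rw [hpre]
    refine setLIntegral_congr_fun measurableSet_Ioi fun x hx => ?_
    have hset : ({u | x ≤ max (-quantile G u) 0} : Set ℝ) =ᵐ[weightedLaw g]
        Ioc 0 (cdf G (-x)) := by
      filter_upwards [hmem] with u hu
      apply propext
      change x ≤ max (-quantile G u) 0 ↔ 0 < u ∧ u ≤ cdf G (-x)
      rw [le_max_iff, or_iff_left (not_le.2 hx), le_neg, quantile_le_iff G hu]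
      exact ⟨fun h => ⟨hu.1, h⟩, fun h => h.2⟩
    rw [measure_congr hset, weightedLaw_Ioc hg hac hint le_rfl (cdf_nonneg G _) (cdf_le_one G _),
      sub_zero, hg.one]
  have hfin : ∀ {f : ℝ → ℝ}, Integrable f (weightedLaw g) →
      ∫⁻ u, ENNReal.ofReal (f u) ∂weightedLaw g ≠ ∞ := fun hf =>
    ((lintegral_ofReal_le_lintegral_enorm _).trans_lt hf.hasFiniteIntegral).ne
  rw [distortionRisk, hpos, hneg, ← hval, integral_eq_lintegral_pos_part_sub_lintegral_neg_part
    hqint, EReal.coe_sub, EReal.coe_ennreal_toReal (hfin hqint),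
    EReal.coe_ennreal_toReal (hfin (f := fun u => -quantile G u) hqint.neg)]

/-! ### Moments of quantile functions and the constraint as a covariance bound. -/

theorem memLp_quantile {G : Measure ℝ} {m s : ℝ} (hG : G ∈ momentSet m s) :
    MemLp (quantile G) 2 unifLaw := by
  have := hG.1
  have h := hG.2.1
  rw [← map_quantile G] at h
  exact h.comp_of_map (aemeasurable_quantile G)

theorem integral_quantile {G : Measure ℝ} {m s : ℝ} (hG : G ∈ momentSet m s) :
    ∫ u, quantile G u ∂unifLaw = m := by
  have := hG.1
  have h := hG.2.2.1
  rwa [← map_quantile G, integral_map (aemeasurable_quantile G) (by fun_prop)] at h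

theorem variance_quantile {G : Measure ℝ} {m s : ℝ} (hG : G ∈ momentSet m s) :
    Var[quantile G; unifLaw] = s ^ 2 := by
  have := hG.1
  have h := hG.2.2.2
  rw [← map_quantile G, integral_map (aemeasurable_quantile G) (by fun_prop)] at h
  rw [variance_eq_sub (memLp_quantile hG), integral_quantile hG]
  simp only [Pi.pow_apply]
  rw [h]; ring

theorem integral_sub_sq {X Y : ℝ → ℝ} (hX : MemLp X 2 unifLaw) (hY : MemLp Y 2 unifLaw) :
    ∫ u, (X u - Y u) ^ 2 ∂unifLaw = (∫ u, X u ∂unifLaw - ∫ u, Y u ∂unifLaw) ^ 2 +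
      Var[X; unifLaw] + Var[Y; unifLaw] - 2 * cov[X, Y; unifLaw] := by
  have h1 := variance_eq_sub (hX.sub hY)
  rw [variance_sub hX hY] at h1
  simp only [Pi.sub_apply, Pi.pow_apply] at h1
  rw [integral_sub (hX.integrable (by norm_num)) (hY.integrable (by norm_num))] at h1
  linarith

theorem integral_quantile_sub_sq {F G : Measure ℝ} {mF sF m s : ℝ} (hF : F ∈ momentSet mF sF)
    (hG : G ∈ momentSet m s) :
    ∫ u, (quantile F u - quantile G u) ^ 2 ∂unifLaw =
      (mF - m) ^ 2 + sF ^ 2 + s ^ 2 - 2 * cov[quantile F, quantile G; unifLaw] := by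
  rw [integral_sub_sq (memLp_quantile hF) (memLp_quantile hG), integral_quantile hF,
    integral_quantile hG, variance_quantile hF, variance_quantile hG]

theorem wasserstein2_eq_sqrt {F G : Measure ℝ} {mF sF m s : ℝ} (hF : F ∈ momentSet mF sF)
    (hG : G ∈ momentSet m s) :
    wasserstein2 F G =
      ENNReal.ofReal (√(∫ u, (quantile F u - quantile G u) ^ 2 ∂unifLaw)) := by
  have := hF.1
  have := hG.1
  rw [wasserstein2_eq, ← ofReal_integral_eq_lintegral_ofReal
    (f := fun u => (quantile F u - quantile G u) ^ 2)
    ((memLp_quantile hF).sub (memLp_quantile hG)).integrable_sq (ae_of_all _ fun u => sq_nonneg _),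
    ENNReal.ofReal_rpow_of_nonneg (integral_nonneg fun u => sq_nonneg _) (by norm_num),
    Real.sqrt_eq_rpow]

theorem wasserstein2_eq_iff {F G : Measure ℝ} {mF sF m s ε : ℝ} (hF : F ∈ momentSet mF sF)
    (hG : G ∈ momentSet m s) (hε : 0 ≤ ε) :
    wasserstein2 F G = ENNReal.ofReal (√ε) ↔
      cov[quantile F, quantile G; unifLaw] = kConst mF sF m s ε := by
  have h0 : 0 ≤ ∫ u, (quantile F u - quantile G u) ^ 2 ∂unifLaw :=
    integral_nonneg fun u => sq_nonneg _
  rw [wasserstein2_eq_sqrt hF hG, ENNReal.ofReal_eq_ofReal_iff (Real.sqrt_nonneg _)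
    (Real.sqrt_nonneg _), Real.sqrt_inj h0 hε, integral_quantile_sub_sq hF hG, kConst]
  constructor <;> intro h <;> linarith

theorem mem_uncertaintySet_iff {F G : Measure ℝ} {mF sF m s ε : ℝ} (hF : F ∈ momentSet mF sF)
    (hG : G ∈ momentSet m s) (hε : 0 ≤ ε) :
    G ∈ uncertaintySet F m s (ENNReal.ofReal ε) ↔
      kConst mF sF m s ε ≤ cov[quantile F, quantile G; unifLaw] := by
  rw [uncertaintySet, mem_ofPred_eq, and_iff_right hG,
    ENNReal.ofReal_rpow_of_nonneg hε (by norm_num), ← Real.sqrt_eq_rpow,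
    wasserstein2_eq_sqrt hF hG, ENNReal.ofReal_le_ofReal_iff (Real.sqrt_nonneg _),
    Real.sqrt_le_sqrt_iff hε, integral_quantile_sub_sq hF hG, kConst]
  constructor <;> intro h <;> linarith

theorem uncertaintySet_mono (F : Measure ℝ) (m s : ℝ) : Monotone (uncertaintySet F m s) :=
  fun _ _ h _ hG => ⟨hG.1, hG.2.trans (ENNReal.rpow_le_rpow h (by norm_num))⟩

/-! ### Variances and covariances of `γ` and `F⁻¹`. -/

/-- Chebyshev's association inequality. -/
theorem covariance_nonneg_of_monotoneOn {f h : ℝ → ℝ} (hf : MonotoneOn f (Ioo 0 1))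
    (hh : MonotoneOn h (Ioo 0 1)) (hf2 : MemLp f 2 unifLaw) (hh2 : MemLp h 2 unifLaw) :
    0 ≤ cov[f, h; unifLaw] := by
  have hfi : Integrable f unifLaw := hf2.integrable (by norm_num)
  have hhi : Integrable h unifLaw := hh2.integrable (by norm_num)
  have hfh : Integrable (fun u => f u * h u) unifLaw := hf2.integrable_mul hh2
  -- This is `(f u - f v) (h u - h v) ≥ 0` integrated over `u`; integrating over `v` as well gives
  -- twice the covariance.
  have key : ∀ v ∈ Ioo (0 : ℝ) 1, 0 ≤ ∫ u, f u * h u ∂unifLaw - (∫ u, f u ∂unifLaw) * h v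
      - f v * (∫ u, h u ∂unifLaw) + f v * h v := by
    intro v hv
    have h0 : 0 ≤ ∫ u, (f u * h u - f u * h v - f v * h u + f v * h v) ∂unifLaw := by
      refine integral_nonneg_of_ae ?_
      filter_upwards [ae_unifLaw_mem] with u hu
      have : 0 ≤ (f u - f v) * (h u - h v) := by
        rcases le_total u v with huv | huv
        · exact mul_nonneg_of_nonpos_of_nonpos (sub_nonpos.2 (hf hu hv huv))
            (sub_nonpos.2 (hh hu hv huv))
        · exact mul_nonneg (sub_nonneg.2 (hf hv hu huv)) (sub_nonneg.2 (hh hv hu huv))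
      change (0 : ℝ) ≤ _
      linarith
    have i1 : Integrable (fun u => f u * h u - f u * h v) unifLaw := hfh.sub (hfi.mul_const _)
    have i2 : Integrable (fun u => f u * h u - f u * h v - f v * h u) unifLaw :=
      i1.sub (hhi.const_mul _)
    rw [integral_add i2 (integrable_const _), integral_sub i1 (hhi.const_mul _),
      integral_sub hfh (hfi.mul_const _), integral_mul_const, integral_const_mul,
      integral_const, probReal_univ, one_smul] at h0
    exact h0
  have h1 : 0 ≤ ∫ v, (∫ u, f u * h u ∂unifLaw - (∫ u, f u ∂unifLaw) * h v
      - f v * (∫ u, h u ∂unifLaw) + f v * h v) ∂unifLaw := by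
    refine integral_nonneg_of_ae ?_
    filter_upwards [ae_unifLaw_mem] with v hv using key v hv
  have i1 : Integrable (fun v => ∫ u, f u * h u ∂unifLaw - (∫ u, f u ∂unifLaw) * h v) unifLaw :=
    (integrable_const _).sub (hhi.const_mul _)
  have i2 : Integrable (fun v => ∫ u, f u * h u ∂unifLaw - (∫ u, f u ∂unifLaw) * h v
      - f v * (∫ u, h u ∂unifLaw)) unifLaw := i1.sub (hfi.mul_const _)
  rw [integral_add i2 hfh, integral_sub i1 (hfi.mul_const _),
    integral_sub (integrable_const _) (hhi.const_mul _), integral_mul_const, integral_const_mul,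
    integral_const, probReal_univ, one_smul] at h1
  rw [covariance_eq_sub hf2 hh2]
  simp only [Pi.mul_apply]
  linarith

/-- Zero variance would make `γ` equal to its mean `1` almost everywhere, hence at points on both
sides of any `u`; monotonicity then forces `γ u = 1`. -/
theorem weightVar_pos {g : ℝ → ℝ} (hg : IsDistortion g) (hconc : ConcaveOn ℝ (Icc 0 1) g)
    (hac : AbsolutelyContinuousOnInterval g 0 1) (hsq : MemLp (weight g) 2 unifLaw)
    (hne : ∃ u ∈ Ioo (0 : ℝ) 1, weight g u ≠ 1) : 0 < weightVar g := by
  refine lt_of_le_of_ne (variance_nonneg _ _) fun h0 => ?_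
  have hae := ae_eq_integral_of_variance_eq_zero hsq h0.symm
  rw [integral_weight_unifLaw hg hac] at hae
  have hex : ∀ a b : ℝ, 0 ≤ a → a < b → b ≤ 1 → ∃ v ∈ Ioc a b, v ∈ Ioo (0 : ℝ) 1 ∧
      weight g v = 1 := by
    intro a b ha hab hb
    by_contra! hcon
    have hnull : unifLaw (Ioc a b) = 0 := by
      refine measure_mono_null (fun v hv => ?_) (hae.and ae_unifLaw_mem)
      exact fun hv' => hcon v hv hv'.2 hv'.1
    rw [unifLaw_Ioc ha hb, ENNReal.ofReal_eq_zero] at hnull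
    linarith
  obtain ⟨u, hu, hu1⟩ := hne
  obtain ⟨v, hv, hv01, hv1⟩ := hex 0 u le_rfl hu.1 hu.2.le
  obtain ⟨w, hw, hw01, hw1⟩ := hex u 1 hu.1.le hu.2 le_rfl
  have hmono := weight_monotoneOn hconc
  exact hu1 (le_antisymm (hw1 ▸ hmono hu hw01 hw.1.le) (hv1 ▸ hmono hv01 hu hv.2))

theorem memLp_mixFun {g : ℝ → ℝ} {F : Measure ℝ} (hsq : MemLp (weight g) 2 unifLaw)
    (hq : MemLp (quantile F) 2 unifLaw) (l : ℝ) : MemLp (mixFun g F l) 2 unifLaw :=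
  hsq.add (hq.const_mul l)

theorem covariance_mixFun {g : ℝ → ℝ} {F : Measure ℝ} (hsq : MemLp (weight g) 2 unifLaw)
    (hq : MemLp (quantile F) 2 unifLaw) (l : ℝ) {X : ℝ → ℝ} (hX : MemLp X 2 unifLaw) :
    cov[X, mixFun g F l; unifLaw] =
      cov[X, weight g; unifLaw] + l * cov[X, quantile F; unifLaw] := by
  have h : mixFun g F l = weight g + l • quantile F := rfl
  rw [h, covariance_add_right hX hsq (hq.const_smul l), covariance_smul_right]

theorem variance_mixFun {g : ℝ → ℝ} {F : Measure ℝ} (hsq : MemLp (weight g) 2 unifLaw)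
    (hq : MemLp (quantile F) 2 unifLaw) (l : ℝ) :
    Var[mixFun g F l; unifLaw] =
      weightVar g + 2 * l * quantileWeightCov g F + l ^ 2 * Var[quantile F; unifLaw] := by
  have h : mixFun g F l = weight g + l • quantile F := rfl
  rw [h, variance_add hsq (hq.const_smul l), covariance_smul_right, variance_smul,
    covariance_comm, weightVar, quantileWeightCov]
  ring

theorem quantileWeightCov_nonneg {g : ℝ → ℝ} {F : Measure ℝ} (hconc : ConcaveOn ℝ (Icc 0 1) g)
    (hsq : MemLp (weight g) 2 unifLaw) (hq : MemLp (quantile F) 2 unifLaw) :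
    0 ≤ quantileWeightCov g F :=
  covariance_nonneg_of_monotoneOn (quantile_monotoneOn F) (weight_monotoneOn hconc) hq hsq

/-! ### The candidate `h_l` and its law. -/

theorem hFun_eq (g : ℝ → ℝ) (F : Measure ℝ) (m s l : ℝ) :
    hFun g F m s l = fun u => (m - s / stdU (mixFun g F l) * ∫ v, mixFun g F l v ∂unifLaw) +
      s / stdU (mixFun g F l) * mixFun g F l u := by
  ext u; rw [hFun]; ring

theorem memLp_hFun {g : ℝ → ℝ} {F : Measure ℝ} (hsq : MemLp (weight g) 2 unifLaw)
    (hq : MemLp (quantile F) 2 unifLaw) (m s l : ℝ) : MemLp (hFun g F m s l) 2 unifLaw := by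
  have haff : ∀ (c d : ℝ) {X : ℝ → ℝ}, MemLp X 2 unifLaw →
      MemLp (fun u => c + d * X u) 2 unifLaw :=
    fun c d _ hX => (memLp_const c).add (hX.const_mul d)
  rw [hFun_eq]
  exact haff _ _ (memLp_mixFun hsq hq l)

theorem integral_hFun {g : ℝ → ℝ} {F : Measure ℝ} (hsq : MemLp (weight g) 2 unifLaw)
    (hq : MemLp (quantile F) 2 unifLaw) (m s l : ℝ) : ∫ u, hFun g F m s l u ∂unifLaw = m := by
  have haff : ∀ (c d : ℝ) {X : ℝ → ℝ}, Integrable X unifLaw →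
      ∫ u, (c + d * X u) ∂unifLaw = c + d * ∫ u, X u ∂unifLaw := by
    intro c d X hX
    rw [integral_add (integrable_const _) (hX.const_mul _), integral_const_mul, integral_const,
      probReal_univ, one_smul]
  rw [hFun_eq, haff _ _ ((memLp_mixFun hsq hq l).integrable (by norm_num))]
  ring

theorem covariance_hFun {g : ℝ → ℝ} {F : Measure ℝ} (hsq : MemLp (weight g) 2 unifLaw)
    (hq : MemLp (quantile F) 2 unifLaw) (m s l : ℝ) (X : ℝ → ℝ) :
    cov[X, hFun g F m s l; unifLaw] =
      s / stdU (mixFun g F l) * cov[X, mixFun g F l; unifLaw] := by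
  rw [hFun_eq, covariance_const_add_right
    (((memLp_mixFun hsq hq l).integrable (by norm_num)).const_mul _), covariance_const_mul_right]

theorem variance_hFun {g : ℝ → ℝ} {F : Measure ℝ} (hsq : MemLp (weight g) 2 unifLaw)
    (hq : MemLp (quantile F) 2 unifLaw) (m s : ℝ) {l : ℝ} (hb : 0 < stdU (mixFun g F l)) :
    Var[hFun g F m s l; unifLaw] = s ^ 2 := by
  have hmix := memLp_mixFun hsq hq l
  rw [hFun_eq, variance_const_add (hmix.const_mul _).aestronglyMeasurable, variance_const_mul,
    ← Real.sq_sqrt (variance_nonneg (mixFun g F l) unifLaw), ← stdU]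
  field_simp

theorem hFun_monotoneOn {g : ℝ → ℝ} (hconc : ConcaveOn ℝ (Icc 0 1) g) (F : Measure ℝ)
    (m : ℝ) {s l : ℝ} (hs : 0 ≤ s) (hl : 0 ≤ l) : MonotoneOn (hFun g F m s l) (Ioo 0 1) := by
  intro u hu v hv huv
  have h1 := weight_monotoneOn hconc hu hv huv
  have h2 := mul_le_mul_of_nonneg_left (quantile_monotoneOn F hu hv huv) hl
  have h3 : mixFun g F l u ≤ mixFun g F l v := add_le_add h1 h2
  have h4 : 0 ≤ stdU (mixFun g F l) := Real.sqrt_nonneg _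
  unfold hFun
  gcongr

theorem hFun_continuousWithinAt {g : ℝ → ℝ} {u : ℝ} (F : Measure ℝ) (m s l : ℝ)
    (hu : u ∈ Ioo (0 : ℝ) 1) (hw : ContinuousAt (weight g) u) :
    ContinuousWithinAt (hFun g F m s l) (Iio u) u := by
  have hq := quantile_continuousWithinAt F hu
  have hw' := hw.continuousWithinAt (s := Iio u)
  have hmix : ContinuousWithinAt (mixFun g F l) (Iio u) u := hw'.add (hq.const_smul l)
  rw [hFun_eq]
  exact continuousWithinAt_const.add (continuousWithinAt_const.mul hmix)

theorem countable_not_continuousAt_weight {g : ℝ → ℝ} (hconc : ConcaveOn ℝ (Icc 0 1) g) :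
    {u ∈ Ioo (0 : ℝ) 1 | ¬ContinuousAt (weight g) u}.Countable := by
  refine (weight_monotoneOn hconc).countable_not_continuousWithinAt.mono ?_
  intro u hu
  exact ⟨hu.1, fun h => hu.2 (h.continuousAt (Ioo_mem_nhds hu.1.1 hu.1.2))⟩

/-- `quantile F` is left-continuous everywhere, so only the countably many jumps of the monotone `γ`
can be exceptional. -/
theorem quantileGivenByH_hLaw {g : ℝ → ℝ} (hconc : ConcaveOn ℝ (Icc 0 1) g) (F : Measure ℝ)
    (m : ℝ) {s l : ℝ} (hs : 0 ≤ s) (hl : 0 ≤ l) :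
    QuantileGivenByH g F m s l (hLaw g F m s l) := by
  have h : ∀ u ∈ Ioo (0 : ℝ) 1, ContinuousAt (weight g) u →
      quantile (hLaw g F m s l) u = hFun g F m s l u := fun u hu hw =>
    quantile_map_eq (hFun_monotoneOn hconc F m hs hl) hu (hFun_continuousWithinAt F m s l hu hw)
  refine ⟨h, (countable_not_continuousAt_weight hconc).mono ?_⟩
  exact fun u hu => ⟨hu.1, fun hw => hu.2 (h u hu.1 hw)⟩

theorem quantile_hLaw_ae_eq {g : ℝ → ℝ} (hconc : ConcaveOn ℝ (Icc 0 1) g) (F : Measure ℝ)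
    (m : ℝ) {s l : ℝ} (hs : 0 ≤ s) (hl : 0 ≤ l) :
    quantile (hLaw g F m s l) =ᵐ[unifLaw] hFun g F m s l :=
  ae_unifLaw_of_countable (quantileGivenByH_hLaw hconc F m hs hl).2

theorem hLaw_mem_momentSet {g : ℝ → ℝ} {F : Measure ℝ} (hsq : MemLp (weight g) 2 unifLaw)
    (hq : MemLp (quantile F) 2 unifLaw) (m s : ℝ) {l : ℝ} (hb : 0 < stdU (mixFun g F l)) :
    hLaw g F m s l ∈ momentSet m s := by
  have hL := memLp_hFun hsq hq m s l
  have hm := hL.aestronglyMeasurable.aemeasurable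
  refine ⟨Measure.isProbabilityMeasure_map hm, ?_, ?_, ?_⟩
  · rw [hLaw, memLp_map_measure_iff (by fun_prop) hm]
    exact hL
  · rw [hLaw, integral_map hm (by fun_prop)]
    exact integral_hFun hsq hq m s l
  · rw [hLaw, integral_map hm (by fun_prop)]
    have h := variance_eq_sub hL
    rw [variance_hFun hsq hq m s hb, integral_hFun hsq hq m s l] at h
    simp only [Pi.pow_apply] at h
    linarith

theorem covariance_congr_right {X Y Y' : ℝ → ℝ} (h : Y =ᵐ[unifLaw] Y') :
    cov[X, Y; unifLaw] = cov[X, Y'; unifLaw] := by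
  rw [covariance, covariance, integral_congr_ae h]
  refine integral_congr_ae ?_
  filter_upwards [h] with u hu
  rw [hu]

/-! ### Optimality by completing the square. -/

theorem distortionRisk_eq_add_covariance {g : ℝ → ℝ} (hg : IsDistortion g)
    (hac : AbsolutelyContinuousOnInterval g 0 1) (hsq : MemLp (weight g) 2 unifLaw)
    {G : Measure ℝ} {m s : ℝ} (hG : G ∈ momentSet m s) :
    distortionRisk g G = ((m + cov[quantile G, weight g; unifLaw] : ℝ) : EReal) := by
  have hq := memLp_quantile hG
  rw [distortionRisk_eq hg hac hsq hq, covariance_comm, covariance_eq_sub hsq hq,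
    integral_weight_unifLaw hg hac, integral_quantile hG]
  simp only [Pi.mul_apply]
  congr 1; ring

theorem stdU_sq (X : ℝ → ℝ) : stdU X ^ 2 = Var[X; unifLaw] := Real.sq_sqrt (variance_nonneg _ _)

/-- `quantile G` and `h_l` share mean and variance, so their covariance is `s²` minus half their
squared distance; scaling by `b_l / s` gives the covariance with `γ + l F⁻¹`. -/
theorem distortionRisk_eq_sub {g : ℝ → ℝ} (hg : IsDistortion g)
    (hac : AbsolutelyContinuousOnInterval g 0 1) (hsq : MemLp (weight g) 2 unifLaw)
    {F G : Measure ℝ} (hq : MemLp (quantile F) 2 unifLaw) {m s l : ℝ} (hG : G ∈ momentSet m s)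
    (hs : 0 < s) (hb : 0 < stdU (mixFun g F l)) :
    distortionRisk g G = ((m + s * stdU (mixFun g F l)
      - l * cov[quantile F, quantile G; unifLaw] - stdU (mixFun g F l) / (2 * s) *
        ∫ u, (quantile G u - hFun g F m s l u) ^ 2 ∂unifLaw : ℝ) : EReal) := by
  have hX := memLp_quantile hG
  have h1 := integral_sub_sq hX (memLp_hFun hsq hq m s l)
  rw [integral_quantile hG, integral_hFun hsq hq, variance_quantile hG,
    variance_hFun hsq hq m s hb, covariance_hFun hsq hq] at h1
  rw [distortionRisk_eq_add_covariance hg hac hsq hG, h1, covariance_mixFun hsq hq l hX,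
    covariance_comm (X := quantile F)]
  congr 1
  field_simp
  ring

theorem valueFormula_eq_sub {g : ℝ → ℝ} (hsq : MemLp (weight g) 2 unifLaw)
    {F : Measure ℝ} (hq : MemLp (quantile F) 2 unifLaw) {m s l : ℝ}
    (hb : 0 < stdU (mixFun g F l)) :
    valueFormula g F m s l = m + s * stdU (mixFun g F l)
      - l * cov[quantile F, hFun g F m s l; unifLaw] := by
  have h2 := stdU_sq (mixFun g F l)
  rw [variance_mixFun hsq hq, ← covariance_self hq.aestronglyMeasurable.aemeasurable] at h2
  rw [valueFormula, covariance_hFun hsq hq, covariance_mixFun hsq hq l hq]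
  rw [quantileWeightCov] at h2 ⊢
  field_simp
  linear_combination (-s) * h2

theorem valueFormula_eq_corr {g : ℝ → ℝ} (hsq : MemLp (weight g) 2 unifLaw)
    {F : Measure ℝ} (hq : MemLp (quantile F) 2 unifLaw) {m s l : ℝ} (hV : 0 < weightVar g) :
    valueFormula g F m s l = m + s * stdU (weight g) * corrU (weight g) (mixFun g F l) := by
  have hP : 0 < stdU (weight g) := Real.sqrt_pos.2 hV
  rw [valueFormula, corrU, covariance_mixFun hsq hq l hsq,
    covariance_self hsq.aestronglyMeasurable.aemeasurable, covariance_comm (X := weight g),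
    quantileWeightCov, weightVar]
  field_simp

/-- Complementary slackness characterises the worst case: `h_l` solves the problem if it is
feasible and no feasible distribution has a smaller covariance with `F⁻¹`, weighted by `l`. -/
theorem worstCase_of_slackness {g : ℝ → ℝ} (hg : IsDistortion g)
    (hconc : ConcaveOn ℝ (Icc 0 1) g)
    (hac : AbsolutelyContinuousOnInterval g 0 1) (hsq : MemLp (weight g) 2 unifLaw)
    {F : Measure ℝ} (hq : MemLp (quantile F) 2 unifLaw) {m s l : ℝ} {ε : ℝ≥0∞}
    (hs : 0 < s) (hl : 0 ≤ l) (hb : 0 < stdU (mixFun g F l))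
    (hmem : hLaw g F m s l ∈ uncertaintySet F m s ε)
    (hcs : ∀ G ∈ uncertaintySet F m s ε, l * cov[quantile F, hFun g F m s l; unifLaw] ≤
      l * cov[quantile F, quantile G; unifLaw]) :
    worstCaseArgmax g F m s ε = {hLaw g F m s l} ∧
      worstCaseValue g F m s ε = distortionRisk g (hLaw g F m s l) ∧
      distortionRisk g (hLaw g F m s l) = (valueFormula g F m s l : ℝ) := by
  have hae := quantile_hLaw_ae_eq hconc F m hs.le hl
  have hval : distortionRisk g (hLaw g F m s l) = (valueFormula g F m s l : ℝ) := by
    have h0 : ∫ u, (quantile (hLaw g F m s l) u - hFun g F m s l u) ^ 2 ∂unifLaw = 0 := by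
      refine integral_eq_zero_of_ae ?_
      filter_upwards [hae] with u hu
      simp [hu]
    rw [distortionRisk_eq_sub hg hac hsq hq hmem.1 hs hb, valueFormula_eq_sub hsq hq hb, h0,
      covariance_congr_right hae, mul_zero, sub_zero]
  have hc : 0 < stdU (mixFun g F l) / (2 * s) := by positivity
  have hI : ∀ G : Measure ℝ, 0 ≤ ∫ u, (quantile G u - hFun g F m s l u) ^ 2 ∂unifLaw :=
    fun G => integral_nonneg fun u => sq_nonneg _
  have hmax : ∀ G ∈ uncertaintySet F m s ε,
      distortionRisk g G ≤ distortionRisk g (hLaw g F m s l) := by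
    intro G hG
    rw [hval, distortionRisk_eq_sub hg hac hsq hq hG.1 hs hb, valueFormula_eq_sub hsq hq hb,
      EReal.coe_le_coe_iff]
    have h1 := hcs G hG
    have h2 := mul_nonneg hc.le (hI G)
    linarith
  refine ⟨?_, ?_, hval⟩
  · ext G
    rw [mem_singleton_iff]
    constructor
    · rintro ⟨hG, hopt⟩
      have h := hopt _ hmem
      rw [hval, distortionRisk_eq_sub hg hac hsq hq hG.1 hs hb, valueFormula_eq_sub hsq hq hb,
        EReal.coe_le_coe_iff] at h
      have h1 := hcs G hG
      -- A second maximiser must have zero squared distance to `h_l`, hence the same law.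
      have h2 : stdU (mixFun g F l) / (2 * s) *
        ∫ u, (quantile G u - hFun g F m s l u) ^ 2 ∂unifLaw ≤ 0 := by linarith
      have h3 : ∫ u, (quantile G u - hFun g F m s l u) ^ 2 ∂unifLaw = 0 :=
        le_antisymm (nonpos_of_mul_nonpos_right h2 hc) (hI G)
      have hdiff : Integrable (fun u => (quantile G u - hFun g F m s l u) ^ 2) unifLaw :=
        ((memLp_quantile hG.1).sub (memLp_hFun hsq hq m s l)).integrable_sq
      rw [integral_eq_zero_iff_of_nonneg (fun u => sq_nonneg _) hdiff] at h3
      have := hG.1.1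
      rw [← map_quantile G, hLaw]
      refine Measure.map_congr ?_
      filter_upwards [h3] with u hu
      exact sub_eq_zero.1 (pow_eq_zero_iff two_ne_zero |>.1 hu)
    · rintro rfl
      exact ⟨hmem, hmax⟩
  · refine le_antisymm (sSup_le ?_) (le_sSup ⟨_, hmem, rfl⟩)
    rintro _ ⟨G, hG, rfl⟩
    exact hmax G hG

theorem stdU_quantile {F : Measure ℝ} {mF sF : ℝ} (hF : F ∈ momentSet mF sF) (hsF : 0 ≤ sF) :
    stdU (quantile F) = sF := by
  rw [stdU, variance_quantile hF, Real.sqrt_sq hsF]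

theorem mixFun_zero (g : ℝ → ℝ) (F : Measure ℝ) : mixFun g F 0 = weight g := by
  ext u; simp [mixFun]

/-! ### The explicit multiplier and the main theorem. -/

/-- The multiplier is determined by the value of the covariance constraint. -/
theorem div_mul_eq_iff_of_sq {s b sF K x D r : ℝ} (hs : 0 < s) (hb : 0 < b) (hsF : 0 < sF)
    (hK : 0 < K) (hx : 0 < x) (hr : 0 ≤ r) (hE : 0 < s ^ 2 * sF ^ 2 - K ^ 2)
    (hb2 : b ^ 2 * sF ^ 2 = D + x ^ 2) (hr2 : r ^ 2 * (s ^ 2 * sF ^ 2 - K ^ 2) = D) :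
    s / b * x = K ↔ x = K * r := by
  -- Squaring and eliminating `b` leaves `x² (s² sF² - K²) = K² D = K² r² (s² sF² - K²)`;
  -- nonnegativity allows returning from squares.
  rw [div_mul_eq_mul_div, div_eq_iff hb.ne']
  constructor
  · intro h
    refine (pow_left_inj₀ hx.le (mul_nonneg hK.le hr) two_ne_zero).1 (mul_right_cancel₀ hE.ne' ?_)
    have h2 : (s * x) ^ 2 = (K * b) ^ 2 := by rw [h]
    linear_combination sF ^ 2 * h2 + K ^ 2 * hb2 - K ^ 2 * hr2
  · intro h
    refine (pow_left_inj₀ (by positivity) (by positivity) two_ne_zero).1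
      (mul_right_cancel₀ (pow_pos hsF 2).ne' ?_)
    have h2 : x ^ 2 = (K * r) ^ 2 := by rw [h]
    linear_combination (s ^ 2 * sF ^ 2 - K ^ 2) * h2 - K ^ 2 * hb2 + K ^ 2 * hr2

/-- The worst-case value as a function of the tolerance, below the threshold. -/
noncomputable def valueOfTolerance (g : ℝ → ℝ) (F : Measure ℝ) (mF sF m s ε : ℝ) : ℝ :=
  m + (√((weightVar g * sF ^ 2 - quantileWeightCov g F ^ 2) *
      (s ^ 2 * sF ^ 2 - kConst mF sF m s ε ^ 2))
    + quantileWeightCov g F * kConst mF sF m s ε) / sF ^ 2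

theorem continuous_valueOfTolerance (g : ℝ → ℝ) (F : Measure ℝ) (mF sF m s : ℝ) :
    Continuous (valueOfTolerance g F mF sF m s) := by
  unfold valueOfTolerance kConst
  fun_prop

theorem theorem1
    (F : Measure ℝ) (mF sF m s : ℝ)
    (hF : F ∈ momentSet mF sF) (hsF : 0 < sF) (hs : 0 < s)
    (g : ℝ → ℝ) (hg : IsDistortion g) (hconc : ConcaveOn ℝ (Icc 0 1) g)
    (hac : AbsolutelyContinuousOnInterval g 0 1)
    (hsq : MemLp (weight g) 2 unifLaw)
    (hne : ∃ u ∈ Ioo (0 : ℝ) 1, weight g u ≠ 1) :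
    -- tolerances below the threshold
    (∀ ε : ℝ, epsLower mF sF m s < ε → ε < epsThreshold g F mF sF m s →
      0 ≤ kConst mF sF m s ε ∧
      0 < lamExplicit g F mF sF m s ε ∧
      (∀ l : ℝ, 0 < l →
        (wasserstein2 F (hLaw g F m s l) = ENNReal.ofReal (√ε) ↔
          l = lamExplicit g F mF sF m s ε)) ∧
      worstCaseArgmax g F m s (ENNReal.ofReal ε) =
        {hLaw g F m s (lamExplicit g F mF sF m s ε)} ∧
      QuantileGivenByH g F m s (lamExplicit g F mF sF m s ε)
        (hLaw g F m s (lamExplicit g F mF sF m s ε)) ∧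
      worstCaseValue g F m s (ENNReal.ofReal ε) =
        distortionRisk g (hLaw g F m s (lamExplicit g F mF sF m s ε)) ∧
      distortionRisk g (hLaw g F m s (lamExplicit g F mF sF m s ε)) =
        (valueFormula g F m s (lamExplicit g F mF sF m s ε) : ℝ) ∧
      valueFormula g F m s (lamExplicit g F mF sF m s ε) =
        m + s * stdU (weight g) *
          corrU (weight g) (mixFun g F (lamExplicit g F mF sF m s ε))) ∧
    -- tolerances above the threshold, including `ε = ∞`
    (∀ ε : ℝ≥0∞, ENNReal.ofReal (epsLower mF sF m s) < ε →
      ENNReal.ofReal (epsThreshold g F mF sF m s) ≤ ε →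
      worstCaseArgmax g F m s ε = {hLaw g F m s 0} ∧
      QuantileGivenByH g F m s 0 (hLaw g F m s 0) ∧
      worstCaseValue g F m s ε = distortionRisk g (hLaw g F m s 0) ∧
      distortionRisk g (hLaw g F m s 0) = (valueFormula g F m s 0 : ℝ) ∧
      valueFormula g F m s 0 =
        m + s * stdU (weight g) * corrU (weight g) (mixFun g F 0)) ∧
    -- continuity in the tolerance
    ContinuousOn (fun ε : ℝ≥0∞ => worstCaseValue g F m s ε)
      (Ioi (ENNReal.ofReal (epsLower mF sF m s))) := by
  have hq := memLp_quantile hF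
  have hV := weightVar_pos hg hconc hac hsq hne
  have hC := quantileWeightCov_nonneg hconc hsq hq
  have hP : 0 < stdU (weight g) := Real.sqrt_pos.2 hV
  have hP2 : stdU (weight g) ^ 2 = weightVar g := stdU_sq _
  have hvar : ∀ l, stdU (mixFun g F l) ^ 2 =
      weightVar g + 2 * l * quantileWeightCov g F + l ^ 2 * sF ^ 2 := by
    intro l
    rw [stdU_sq, variance_mixFun hsq hq, variance_quantile hF]
  have hb : ∀ l, 0 ≤ l → 0 < stdU (mixFun g F l) := by
    intro l hl
    refine lt_of_le_of_ne (Real.sqrt_nonneg _) fun h => ?_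
    have h1 := hvar l
    rw [← h] at h1
    have h2 := mul_nonneg (mul_nonneg zero_le_two hl) hC
    have h3 := mul_nonneg (sq_nonneg l) (sq_nonneg sF)
    linarith
  have hcovh : ∀ l, cov[quantile F, hFun g F m s l; unifLaw] =
      s / stdU (mixFun g F l) * (quantileWeightCov g F + l * sF ^ 2) := by
    intro l
    rw [covariance_hFun hsq hq, covariance_mixFun hsq hq l hq,
      covariance_self hq.aestronglyMeasurable.aemeasurable, variance_quantile hF,
      quantileWeightCov]
  have hmom : ∀ l, 0 ≤ l → hLaw g F m s l ∈ momentSet m s :=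
    fun l hl => hLaw_mem_momentSet hsq hq m s (hb l hl)
  have hcovL : ∀ l, 0 ≤ l → cov[quantile F, quantile (hLaw g F m s l); unifLaw] =
      cov[quantile F, hFun g F m s l; unifLaw] :=
    fun l hl => covariance_congr_right (quantile_hLaw_ae_eq hconc F m hs.le hl)
  have hlower : 0 ≤ epsLower mF sF m s := add_nonneg (sq_nonneg _) (sq_nonneg _)
  have hthr : epsThreshold g F mF sF m s =
      epsLower mF sF m s + 2 * s * sF - 2 * s * quantileWeightCov g F / stdU (weight g) := by
    rw [epsThreshold, corrU, stdU_quantile hF hsF.le, quantileWeightCov]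
    field_simp
    ring
  -- `K` decreases in `ε`, from `s * sF` at the lower bound to `s C / std γ` at the threshold;
  -- between them this gives `hKs` and `hKP`.
  have hKeq : ∀ ε, kConst mF sF m s ε = (epsLower mF sF m s + 2 * s * sF - ε) / 2 := by
    intro ε; rw [kConst, epsLower]; ring
  have hKthr : kConst mF sF m s (epsThreshold g F mF sF m s) =
      s * quantileWeightCov g F / stdU (weight g) := by
    rw [hKeq, hthr]; ring
  -- Cauchy–Schwarz, read off from `Var (γ + l F⁻¹) ≥ 0` at the minimising `l = -C / sF²`.
  have hD0 : quantileWeightCov g F ^ 2 ≤ weightVar g * sF ^ 2 := by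
    have h := hvar (-quantileWeightCov g F / sF ^ 2)
    have h0 := sq_nonneg (stdU (mixFun g F (-quantileWeightCov g F / sF ^ 2)))
    rw [h] at h0
    have h1 : weightVar g + 2 * (-quantileWeightCov g F / sF ^ 2) * quantileWeightCov g F +
        (-quantileWeightCov g F / sF ^ 2) ^ 2 * sF ^ 2 =
        (weightVar g * sF ^ 2 - quantileWeightCov g F ^ 2) / sF ^ 2 := by
      field_simp; ring
    rw [h1] at h0
    have := (le_div_iff₀ (pow_pos hsF 2)).1 h0
    linarith
  have hthr_lower : epsLower mF sF m s ≤ epsThreshold g F mF sF m s := by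
    have h : quantileWeightCov g F ≤ sF * stdU (weight g) := by
      refine (pow_le_pow_iff_left₀ hC (by positivity) two_ne_zero).1 ?_
      rw [mul_pow, hP2]; linarith
    have h2 : 2 * s * quantileWeightCov g F / stdU (weight g) ≤ 2 * s * sF := by
      rw [div_le_iff₀ hP]
      nlinarith
    rw [hthr]; linarith
  have below : ∀ ε : ℝ, epsLower mF sF m s < ε → ε < epsThreshold g F mF sF m s →
      0 ≤ kConst mF sF m s ε ∧ 0 < lamExplicit g F mF sF m s ε ∧
      (∀ l : ℝ, 0 < l → (wasserstein2 F (hLaw g F m s l) = ENNReal.ofReal (√ε) ↔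
        l = lamExplicit g F mF sF m s ε)) ∧
      (worstCaseArgmax g F m s (ENNReal.ofReal ε) =
        {hLaw g F m s (lamExplicit g F mF sF m s ε)} ∧
      worstCaseValue g F m s (ENNReal.ofReal ε) =
        distortionRisk g (hLaw g F m s (lamExplicit g F mF sF m s ε)) ∧
      distortionRisk g (hLaw g F m s (lamExplicit g F mF sF m s ε)) =
        (valueFormula g F m s (lamExplicit g F mF sF m s ε) : ℝ)) ∧
      valueFormula g F m s (lamExplicit g F mF sF m s ε) =
        valueOfTolerance g F mF sF m s ε := by
    intro ε h1 h2
    have hε : 0 ≤ ε := hlower.trans h1.le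
    have hKP : s * quantileWeightCov g F < kConst mF sF m s ε * stdU (weight g) := by
      rw [← div_lt_iff₀ hP, ← hKthr, hKeq, hKeq]; linarith
    have hKs : kConst mF sF m s ε < s * sF := by rw [hKeq]; linarith
    have hlam : lamExplicit g F mF sF m s ε = (kConst mF sF m s ε *
        √((weightVar g * sF ^ 2 - quantileWeightCov g F ^ 2) /
          (s ^ 2 * sF ^ 2 - kConst mF sF m s ε ^ 2)) - quantileWeightCov g F) / sF ^ 2 := by
      rw [lamExplicit, ← neg_div_neg_eq (quantileWeightCov g F ^ 2 - weightVar g * sF ^ 2),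
        neg_sub, neg_sub]
      ring
    have hval : valueOfTolerance g F mF sF m s ε = m +
      (√((weightVar g * sF ^ 2 - quantileWeightCov g F ^ 2) *
        (s ^ 2 * sF ^ 2 - kConst mF sF m s ε ^ 2))
        + quantileWeightCov g F * kConst mF sF m s ε) / sF ^ 2 := rfl
    have hmemiff : ∀ G ∈ momentSet m s, G ∈ uncertaintySet F m s (ENNReal.ofReal ε) ↔
        kConst mF sF m s ε ≤ cov[quantile F, quantile G; unifLaw] :=
      fun G hG => mem_uncertaintySet_iff hF hG hε
    have hWiff : ∀ l, 0 ≤ l → (wasserstein2 F (hLaw g F m s l) = ENNReal.ofReal (√ε) ↔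
        s / stdU (mixFun g F l) * (quantileWeightCov g F + l * sF ^ 2) =
          kConst mF sF m s ε) := by
      intro l hl
      rw [wasserstein2_eq_iff hF (hmom l hl) hε, hcovL l hl, hcovh]
    generalize kConst mF sF m s ε = K at *
    generalize lamExplicit g F mF sF m s ε = lam at *
    have hK : 0 < K := by
      refine pos_of_mul_pos_left ((mul_nonneg hs.le hC).trans_lt hKP) hP.le
    have hE : 0 < s ^ 2 * sF ^ 2 - K ^ 2 := by
      have := pow_lt_pow_left₀ hKs hK.le two_ne_zero
      rw [mul_pow] at this; linarith
    have hKV : s ^ 2 * quantileWeightCov g F ^ 2 < K ^ 2 * weightVar g := by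
      have := pow_lt_pow_left₀ hKP (mul_nonneg hs.le hC) two_ne_zero
      rwa [mul_pow, mul_pow, hP2] at this
    set V := weightVar g
    set C := quantileWeightCov g F
    set D := V * sF ^ 2 - C ^ 2
    set r := √(D / (s ^ 2 * sF ^ 2 - K ^ 2)) with hr_def
    have hD : 0 ≤ D := sub_nonneg.2 hD0
    have hr : 0 ≤ r := Real.sqrt_nonneg _
    have hr2 : r ^ 2 * (s ^ 2 * sF ^ 2 - K ^ 2) = D := by
      rw [hr_def, Real.sq_sqrt (div_nonneg hD hE.le), div_mul_cancel₀ _ hE.ne']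
    -- Positivity means `C < K r`; squared and multiplied by `s² sF² - K²`, it reduces to `hKV`.
    have hlam_pos : 0 < lam := by
      rw [hlam]
      refine div_pos (sub_pos.2 ?_) (by positivity)
      refine (pow_lt_pow_iff_left₀ hC (by positivity) two_ne_zero).1 ?_
      refine lt_of_mul_lt_mul_right ?_ hE.le
      have : (K * r) ^ 2 * (s ^ 2 * sF ^ 2 - K ^ 2) = K ^ 2 * D := by rw [← hr2]; ring
      rw [this]
      have := mul_lt_mul_of_pos_right hKV (pow_pos hsF 2)
      simp only [D]
      linarith
    have hxlam : C + lam * sF ^ 2 = K * r := by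
      rw [hlam]; field_simp; ring
    have hiff : ∀ l, 0 < l → (s / stdU (mixFun g F l) * (C + l * sF ^ 2) = K ↔ l = lam) := by
      intro l hl
      rw [div_mul_eq_iff_of_sq (sF := sF) (D := D) hs (hb l hl.le) hsF hK (by positivity) hr hE
        (by rw [hvar]; simp only [D]; ring) hr2, ← hxlam, add_right_inj,
        mul_left_inj' (pow_pos hsF 2).ne']
    have hcovlam : s / stdU (mixFun g F lam) * (C + lam * sF ^ 2) = K :=
      (hiff lam hlam_pos).2 rfl
    refine ⟨hK.le, hlam_pos, fun l hl => (hWiff l hl.le).trans (hiff l hl), ?_, ?_⟩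
    · refine worstCase_of_slackness hg hconc hac hsq hq hs hlam_pos.le (hb lam hlam_pos.le) ?_ ?_
      · rw [hmemiff _ (hmom lam hlam_pos.le), hcovL lam hlam_pos.le, hcovh, hcovlam]
      · intro G hG
        -- The constraint binds at `h_lam`, so every feasible covariance is at least that of
        -- `h_lam`.
        rw [hcovh, hcovlam]
        exact mul_le_mul_of_nonneg_left ((hmemiff G hG.1).1 hG) hlam_pos.le
    · have hrE : √(D * (s ^ 2 * sF ^ 2 - K ^ 2)) = r * (s ^ 2 * sF ^ 2 - K ^ 2) := by
        rw [← hr2, mul_assoc, ← sq, ← mul_pow, Real.sqrt_sq (mul_nonneg hr hE.le)]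
      have hbr : stdU (mixFun g F lam) = s * r := by
        have := hb lam hlam_pos.le
        rw [hxlam, div_mul_eq_mul_div, div_eq_iff this.ne'] at hcovlam
        exact mul_left_cancel₀ hK.ne' (by linear_combination -hcovlam)
      rw [valueFormula_eq_sub hsq hq (hb lam hlam_pos.le), hcovh, hcovlam, hval, hrE, hbr, hlam]
      field_simp
      ring
  have above : ∀ ε : ℝ≥0∞, ENNReal.ofReal (epsThreshold g F mF sF m s) ≤ ε →
      worstCaseArgmax g F m s ε = {hLaw g F m s 0} ∧
      worstCaseValue g F m s ε = distortionRisk g (hLaw g F m s 0) ∧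
      distortionRisk g (hLaw g F m s 0) = (valueFormula g F m s 0 : ℝ) := by
    intro ε hε
    -- Slackness is trivial for `l = 0`; `h_0` meets the constraint with equality at the threshold,
    -- and the uncertainty sets grow with `ε`.
    refine worstCase_of_slackness hg hconc hac hsq hq hs le_rfl (hb 0 le_rfl)
      (uncertaintySet_mono F m s hε ?_) fun G _ => by simp
    rw [mem_uncertaintySet_iff hF (hmom 0 le_rfl) (hlower.trans hthr_lower), hKthr,
      hcovL 0 le_rfl, hcovh, mixFun_zero]
    apply le_of_eq
    ring
  have hval0 : valueFormula g F m s 0 =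
      valueOfTolerance g F mF sF m s (epsThreshold g F mF sF m s) := by
    -- At the threshold `s² sF² - K² = s² D / V` with `D = V sF² - C²`, so the radicand is a perfect
    -- square.
    have hsqrt : √((weightVar g * sF ^ 2 - quantileWeightCov g F ^ 2) * (s ^ 2 * sF ^ 2 -
        (s * quantileWeightCov g F / stdU (weight g)) ^ 2)) =
        (weightVar g * sF ^ 2 - quantileWeightCov g F ^ 2) * s / stdU (weight g) := by
      rw [← Real.sqrt_sq (div_nonneg (mul_nonneg (sub_nonneg.2 hD0) hs.le) hP.le)]
      congr 1
      rw [← hP2]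
      field_simp
    rw [valueFormula, valueOfTolerance, hKthr, hsqrt, mixFun_zero, ← hP2]
    field_simp
    ring
  refine ⟨?_, ?_, ?_⟩
  · intro ε h1 h2
    obtain ⟨hK, hlam, hW, ⟨h3, h4, h5⟩, -⟩ := below ε h1 h2
    exact ⟨hK, hlam, hW, h3, quantileGivenByH_hLaw hconc F m hs.le hlam.le, h4, h5,
      valueFormula_eq_corr hsq hq hV⟩
  · intro ε _ h2
    obtain ⟨h3, h4, h5⟩ := above ε h2
    exact ⟨h3, quantileGivenByH_hLaw hconc F m hs.le le_rfl, h4, h5,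
      valueFormula_eq_corr hsq hq hV⟩
  -- Capping `ε` at the threshold merges both regimes into one formula and keeps `toReal` away from
  -- `∞`, where it is discontinuous.
  · have hformula : ∀ ε ∈ Ioi (ENNReal.ofReal (epsLower mF sF m s)), worstCaseValue g F m s ε =
        ((valueOfTolerance g F mF sF m s
          (min ε (ENNReal.ofReal (epsThreshold g F mF sF m s))).toReal : ℝ) : EReal) := by
      intro ε hε
      rcases le_or_gt (ENNReal.ofReal (epsThreshold g F mF sF m s)) ε with h | h
      · obtain ⟨-, h4, h5⟩ := above ε h
        rw [min_eq_right h, ENNReal.toReal_ofReal (hlower.trans hthr_lower), h4, h5, hval0]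
      · have htop : ε ≠ ∞ := (h.trans ENNReal.ofReal_lt_top).ne
        have hlt := (ENNReal.ofReal_lt_iff_lt_toReal hlower htop).1 hε
        have hgt := (ENNReal.lt_ofReal_iff_toReal_lt htop).1 h
        obtain ⟨-, -, -, ⟨-, h4, h5⟩, h6⟩ := below ε.toReal hlt hgt
        rw [ENNReal.ofReal_toReal htop] at h4
        rw [min_eq_left h.le, h4, h5, h6]
    refine ContinuousOn.congr (Continuous.continuousOn ?_) hformula
    refine continuous_coe_real_ereal.comp ((continuous_valueOfTolerance g F mF sF m s).comp ?_)
    exact ENNReal.continuousOn_toReal.comp_continuous (continuous_id.min continuous_const)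
      fun ε => ((min_le_right _ _).trans_lt ENNReal.ofReal_lt_top).ne
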